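/- **Setting.** Let $K\subseteq\mathbb R^n$ be nonempty, closed and convex. Let $f:\mathbb R^n\to\mathbb R$, $g:\mathbb R^n\to\mathbb R^m$, $h:\mathbb R^n\to\mathbb R^p$ be $C^{1,1}$ (continuously differentiable with locally Lipschitz gradients) on an open set containing $K$. Let $q:\mathbb R^n\to\mathbb R$ be convex on $K$ and locally Lipschitz on an open set containing $K$. Consider $$\text{(P)}\qquad \min_x\ f(x)+q(x)\quad\text{s.t. } g(x)\le 0,\ h(x)=0,\ x\in K .$$ Write $\nabla g(x)$, $\nabla h(x)$ for the transposed Jacobians, $N_C(x)$ for the normal cone of convex analysis, $\partial q(x)=\{v: q(y)\ge q(x)+v^T(y-x)\ \forall y\in K\}$ for $x\in K$, $\varphi(x)=\max_{i,j}\{\max(g_i(x),0),|h_j(x)|\}$ (equal to $0$ if $m=p=0$), $\mathbb B_\infty^k$ for the closed unit ball of the infinity norm in $\mathbb R^k$, and $e$ for the all-ones vector. A point $x\in K$ is a *KKT solution* of (P) if $g(x)\le0$, $h(x)=0$ and there are $\xi\in N_{\mathbb R^m_-}(g(x))$ and $\pi\in\mathbb R^p$ with $0\in\nabla f(x)+\partial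 q(x)+\nabla g(x)\xi+\nabla h(x)\pi+N_K(x)$. The *eMFCQ* holds at $x\in K$ if $(\xi,\pi)=(0,0)$ is the only pair with $\xi\in N_{\mathbb R^m_-}(g(x)-\varphi(x)e)$, $\pi\in N_{\varphi(x)\mathbb B^p_\infty}(h(x))$ and $0\in\nabla g(x)\xi+\nabla h(x)\pi+N_K(x)$. **Assumptions.** Let $\beta>0$ be at least the diameter of $K$ in the infinity norm, and let $O_d\supseteq\beta\mathbb B^n_\infty$ and $O_x\supseteq K$ be open. * (A) $\tilde f:O_d\times O_x\to\mathbb R$ is continuously differentiable in its first argument; $\tilde f$ and its partial gradient $\nabla_1\tilde f$ with respect to the first argument are continuous on $O_d\times O_x$; there is $c>0$ such that $\tilde f(\cdot;x)$ is strongly convex on $O_d$ with modulus $c$ for every $x\in K$; and $\nabla_1\tilde f(0;x)=\nabla f(x)$ for every $x\in K$. * (C) $\tilde f$ is locally Lipschitz on $O_d\times O_x$. * (D) On an open neighborhood of $K$ each $g_i$ is convex and $h(x)=Ax+b$ for some $A\in\mathbb R^{p\times n}$, $b\in\mathbb R^p$; $K$ is bounded; (P) has a feasible point; the eMFCQ holds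 at every point of $K$. **Algorithm.** Given $\gamma^\nu\in(0,1]$ with $\gamma^\nu\to0$ and $\sum_\nu\gamma^\nu=\infty$, start from $x^0\in K$. At iteration $\nu$: if $x^\nu$ is a KKT solution of (P), stop and return $x^\nu$; otherwise let $d(x^\nu)$ be the solution of $$\text{(P}^c_{x^\nu})\qquad \min_d\ \tilde f(d;x^\nu)+q(x^\nu+d)\quad\text{s.t. } g(x^\nu)+\nabla g(x^\nu)^Td\le0,\ A(x^\nu+d)+b=0,\ x^\nu+d\in K,$$ and set $x^{\nu+1}=x^\nu+\gamma^\nu d(x^\nu)$. (If the algorithm stops at $x^\nu$, the sequence is continued by the constant value $x^\nu$.) **Theorem.** For every $x\in K$ the subproblem (P$^c_x$) has a unique solution, so the algorithm is well defined. Every sequence $\{x^\nu\}$ that it generates is bounded and contained in $K$, and each limit point of $\{x^\nu\}$ is a KKT solution of (P). -/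

import Mathlib

noncomputable section

namespace GhostDSM

/-- `ℝⁿ` with the Euclidean norm and inner product. -/
abbrev E (n : ℕ) : Type := EuclideanSpace ℝ (Fin n)

/-- The normal cone, in the sense of convex analysis, to `C` at `x` (empty if `x ∉ C`). -/
def normalCone {n : ℕ} (C : Set (E n)) (x : E n) : Set (E n) :=
  {v | x ∈ C ∧ ∀ y ∈ C, inner ℝ v (y - x) ≤ 0}

/-- The subdifferential at `x` of a function `q` that is convex on `K`. Only points of `K` enter
the subgradient inequality, because `q` is not assumed to be convex outside `K`. -/
def subdiff {n : ℕ} (K : Set (E n)) (q : E n → ℝ) (x : E n) : Set (E n) :=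
  {v | ∀ y ∈ K, q x + inner ℝ v (y - x) ≤ q y}

/-- The nonpositive orthant of `ℝᵐ`. -/
def nonposOrthant (m : ℕ) : Set (E m) := {y | ∀ i, y i ≤ 0}

/-- The closed ball of radius `r` around the origin in `ℝᵖ` for the infinity norm. -/
def supBall (p : ℕ) (r : ℝ) : Set (E p) := {z | ∀ j, |z j| ≤ r}

/-- `∇G(x) ξ`, where `∇G(x)` is the transposed Jacobian of `G : ℝⁿ → ℝᵏ` at `x`. -/
def jacT {n k : ℕ} (G : E n → E k) (x : E n) (ξ : E k) : E n :=
  ∑ i, ξ i • gradient (fun y => G y i) x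

/-- `C^{1,1}` on an open set `U`: differentiable with locally Lipschitz gradient. -/
def C11On {n : ℕ} (F : E n → ℝ) (U : Set (E n)) : Prop :=
  DifferentiableOn ℝ F U ∧ LocallyLipschitzOn U (gradient F)

/-- The data of the problem: minimize `f x + q x` subject to `g x ≤ 0`, `h x = 0`, `x ∈ K`. -/
structure Problem (n m p : ℕ) where
  K : Set (E n)
  f : E n → ℝ
  q : E n → ℝ
  g : E n → E m
  h : E n → E p

namespace Problem

variable {n m p : ℕ}

/-- The standing assumptions on the problem. -/
structure Standing (P : Problem n m p) : Prop where
  nonempty : P.K.Nonempty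
  closed : IsClosed P.K
  convex : Convex ℝ P.K
  smooth : ∃ U : Set (E n), IsOpen U ∧ P.K ⊆ U ∧ C11On P.f U ∧
    (∀ i, C11On (fun x => P.g x i) U) ∧ ∀ j, C11On (fun x => P.h x j) U
  q_convex : ConvexOn ℝ P.K P.q
  q_lipschitz : ∃ U : Set (E n), IsOpen U ∧ P.K ⊆ U ∧ LocallyLipschitzOn U P.q

/-- The feasible set. -/
def feasible (P : Problem n m p) : Set (E n) :=
  {x | (∀ i, P.g x i ≤ 0) ∧ P.h x = 0 ∧ x ∈ P.K}

/-- The constraint violation `max_{i,j} {g_i(x)₊, |h_j(x)|}` (zero without constraints). -/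
def viol (P : Problem n m p) (x : E n) : ℝ :=
  max (⨆ i, max (P.g x i) 0) (⨆ j, |P.h x j|)

/-- The set of KKT multipliers at `x`. -/
def M1 (P : Problem n m p) (x : E n) : Set (E m × E p) :=
  {μ | μ.1 ∈ normalCone (nonposOrthant m) (P.g x) ∧
    μ.2 ∈ normalCone {0} (P.h x) ∧
    ∃ ρ ∈ subdiff P.K P.q x, ∃ ζ ∈ normalCone P.K x,
      gradient P.f x + ρ + jacT P.g x μ.1 + jacT P.h x μ.2 + ζ = 0}

/-- The set of abnormal multipliers at `x`. -/
def M0 (P : Problem n m p) (x : E n) : Set (E m × E p) :=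
  {μ | μ.1 ∈ normalCone (nonposOrthant m) (WithLp.toLp 2 fun i => P.g x i - P.viol x) ∧
    μ.2 ∈ normalCone (supBall p (P.viol x)) (P.h x) ∧
    ∃ ζ ∈ normalCone P.K x, jacT P.g x μ.1 + jacT P.h x μ.2 + ζ = 0}

/-- KKT solutions of the problem. -/
def IsKKT (P : Problem n m p) (x : E n) : Prop :=
  x ∈ P.K ∧ (∀ i, P.g x i ≤ 0) ∧ P.h x = 0 ∧ (P.M1 x).Nonempty

/-- The extended Mangasarian-Fromovitz constraint qualification at `x`. -/
def EMFCQ (P : Problem n m p) (x : E n) : Prop := P.M0 x = {0}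

/-- The conditions on the surrogate `ft d x` of the objective `f`, which is used for `(d, x)` in
`Od ×ˢ Ox`, where `Od` is an open neighborhood of the sup-norm ball of radius `β`, and `Ox` is one
of `K`. -/
structure AssumptionA (P : Problem n m p) (ft : E n → E n → ℝ) (β : ℝ) (Od Ox : Set (E n)) :
    Prop where
  Od_open : IsOpen Od
  ball_subset : supBall n β ⊆ Od
  Ox_open : IsOpen Ox
  K_subset : P.K ⊆ Ox
  contDiff : ∀ x ∈ Ox, ContDiffOn ℝ 1 (fun d => ft d x) Od
  strongConvex : ∃ c : ℝ, 0 < c ∧ ∀ x ∈ P.K, StrongConvexOn Od c (fun d => ft d x)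
  cont : ContinuousOn (fun z : E n × E n => ft z.1 z.2) (Od ×ˢ Ox)
  grad_cont : ContinuousOn (fun z : E n × E n => gradient (fun d => ft d z.2) z.1) (Od ×ˢ Ox)
  grad_zero : ∀ x ∈ P.K, gradient (fun d => ft d x) 0 = gradient P.f x

/-- The surrogate of the objective is locally Lipschitz continuous in both arguments jointly. -/
def AssumptionC (ft : E n → E n → ℝ) (Od Ox : Set (E n)) : Prop :=
  LocallyLipschitzOn (Od ×ˢ Ox) (fun z : E n × E n => ft z.1 z.2)

/-- Convex inequality constraints, affine equality constraints `A x + b = 0`, bounded `K`,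
nonempty feasible set, eMFCQ on all of `K`. -/
structure AssumptionD (P : Problem n m p) (A : Matrix (Fin p) (Fin n) ℝ) (b : E p) : Prop where
  convex_affine : ∃ V : Set (E n), IsOpen V ∧ P.K ⊆ V ∧
    (∀ i, ConvexOn ℝ V (fun x => P.g x i)) ∧ ∀ x ∈ V, P.h x = A.toEuclideanLin x + b
  bounded : Bornology.IsBounded P.K
  feasible_nonempty : P.feasible.Nonempty
  emfcq : ∀ x ∈ P.K, P.EMFCQ x

/-- The feasible set of the direction-finding subproblem at `x`. -/
def subFeasible (P : Problem n m p) (A : Matrix (Fin p) (Fin n) ℝ) (b : E p) (x : E n) :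
    Set (E n) :=
  {d | (∀ i, P.g x i + inner ℝ (gradient (fun y => P.g y i) x) d ≤ 0) ∧
    A.toEuclideanLin (x + d) + b = 0 ∧ x + d ∈ P.K}

/-- `d` solves the subproblem at `x`: it minimizes `ft d x + q (x + d)` over its feasible set. -/
def IsDirection (P : Problem n m p) (A : Matrix (Fin p) (Fin n) ℝ) (b : E p)
    (ft : E n → E n → ℝ) (x d : E n) : Prop :=
  d ∈ P.subFeasible A b x ∧ IsMinOn (fun d' => ft d' x + P.q (x + d')) (P.subFeasible A b x) d

/-- Admissible stepsizes: in `(0, 1]`, vanishing, with divergent sum. -/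
structure IsStepsize (γ : ℕ → ℝ) : Prop where
  pos : ∀ ν, 0 < γ ν
  le_one : ∀ ν, γ ν ≤ 1
  tendsto_zero : Filter.Tendsto γ Filter.atTop (nhds 0)
  sum_diverges : Filter.Tendsto (fun N => ∑ ν ∈ Finset.range N, γ ν) Filter.atTop Filter.atTop

/-- `x` is generated by the simplified algorithm with stepsizes `γ`: it starts in `K`; if `x ν` is
a KKT solution the algorithm stops and returns it (the sequence then stays there forever);
otherwise it moves from `x ν` by `γ ν` times a solution of the subproblem at `x ν`. -/
structure IsRun (P : Problem n m p) (A : Matrix (Fin p) (Fin n) ℝ) (b : E p)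
    (ft : E n → E n → ℝ) (γ : ℕ → ℝ) (x : ℕ → E n) : Prop where
  init : x 0 ∈ P.K
  stay : ∀ ν, P.IsKKT (x ν) → x (ν + 1) = x ν
  move : ∀ ν, ¬ P.IsKKT (x ν) → ∃ d, P.IsDirection A b ft (x ν) d ∧ x (ν + 1) = x ν + γ ν • d

end Problem

end GhostDSM

end

open Filter Topology Set

namespace GhostDSM

/-! The argument combines exact penalization with multipliers that are bounded uniformly over all
subproblems.

At a feasible point the violation vanishes, and the eMFCQ says that no nonzero multiplier makes the
constraint part of the Lagrangian nonnegative on `K`. Scaling and compactness turn this into a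
linear estimate of `‖μ‖` by the amount that this part falls below zero
(`exists_multiplier_norm_le`). Linearizations of convex `g` lie below `g`, so the same estimate
serves every subproblem. Fed into Sion's minimax theorem, it gives multipliers of norm at most a
common `R` (`exists_direction_multiplier`).

With penalty parameter `R`, strong convexity makes every direction one of descent for the `ℓ¹` merit
function, up to an error quadratic in the step (`exists_merit_descent`). If the directions stayed
away from zero near a cluster point, the merit value would have to decrease without bound, because
the stepsizes have divergent sum (`not_mapClusterPt_of_descent`). Hence directions vanish along some
iterates tending to the cluster point, and the saddle inequalities pass to the limit and yield the
KKT conditions there (`isKKT_of_tendsto_direction`). -/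

/-! ### One-sided derivative estimates, convexity and quadratic bounds. -/

/-- The right difference quotient at `0` does not see terms of order `t ^ 2`, whatever the sign of
`C`. All first-order conditions below are read off from inequalities along segments in this way. -/
theorem deriv_le_of_forall_le_add_mul {φ : ℝ → ℝ} {φ' a C : ℝ} (hφ : HasDerivAt φ φ' 0)
    (h : ∀ t, 0 < t → t ≤ 1 → φ t ≤ φ 0 + t * a + t ^ 2 * C) : φ' ≤ a := by
  have h1 : Tendsto (fun t : ℝ => t⁻¹ • (φ (0 + t) - φ 0)) (𝓝[>] 0) (𝓝 φ') :=
    hφ.tendsto_slope_zero_right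
  have h2 : Tendsto (fun t : ℝ => a + t * C) (𝓝[>] 0) (𝓝 a) := by
    have : Tendsto (fun t : ℝ => a + t * C) (𝓝 0) (𝓝 (a + 0 * C)) :=
      Continuous.tendsto (by fun_prop) 0
    rw [zero_mul, add_zero] at this
    exact this.mono_left nhdsWithin_le_nhds
  refine le_of_tendsto_of_tendsto h1 h2 ?_
  filter_upwards [Ioc_mem_nhdsGT (zero_lt_one (α := ℝ))] with t ht
  have := h t ht.1 ht.2
  rw [zero_add, smul_eq_mul, inv_mul_le_iff₀ ht.1]
  nlinarith

theorem le_deriv_of_forall_add_mul_le {φ : ℝ → ℝ} {φ' a C : ℝ} (hφ : HasDerivAt φ φ' 0)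
    (h : ∀ t, 0 < t → t ≤ 1 → φ 0 + t * a + t ^ 2 * C ≤ φ t) : a ≤ φ' := by
  have := deriv_le_of_forall_le_add_mul (a := -a) (C := -C) hφ.neg
    (fun t h0 h1 => by have := h t h0 h1; simp only [Pi.neg_apply]; linarith)
  linarith

variable {n k : ℕ}

theorem hasDerivAt_line {F : E n → ℝ} {x : E n} (hF : DifferentiableAt ℝ F x) (v : E n) :
    HasDerivAt (fun t : ℝ => F (x + t • v)) (inner ℝ (gradient F x) v) 0 := by
  have h1 : HasDerivAt (fun t : ℝ => x + t • v) v 0 := by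
    simpa using ((hasDerivAt_id (0 : ℝ)).smul_const v).const_add x
  have h2 : HasFDerivAt F (fderiv ℝ F x) (x + (0 : ℝ) • v) := by
    simpa using hF.hasFDerivAt
  rw [inner_gradient_left]
  exact h2.comp_hasDerivAt 0 h1

theorem segment_mem {K : Set (E n)} (hK : Convex ℝ K) {x y : E n} (hx : x ∈ K) (hy : y ∈ K)
    {t : ℝ} (h0 : 0 ≤ t) (h1 : t ≤ 1) : x + t • (y - x) ∈ K :=
  hK.add_smul_sub_mem hx hy ⟨h0, h1⟩

theorem ConvexOn.le_segment {K : Set (E n)} {F : E n → ℝ} (hF : ConvexOn ℝ K F) {x y : E n}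
    (hx : x ∈ K) (hy : y ∈ K) {t : ℝ} (h0 : 0 ≤ t) (h1 : t ≤ 1) :
    F (x + t • (y - x)) ≤ F x + t * (F y - F x) := by
  have := hF.2 hx hy (sub_nonneg.2 h1) h0 (by ring)
  have e : (1 - t) • x + t • y = x + t • (y - x) := by module
  rw [e, smul_eq_mul, smul_eq_mul] at this
  linarith

theorem ConvexOn.add_inner_gradient_le {K : Set (E n)} {F : E n → ℝ} (hF : ConvexOn ℝ K F)
    {x y : E n} (hd : DifferentiableAt ℝ F x) (hx : x ∈ K) (hy : y ∈ K) :
    F x + inner ℝ (gradient F x) (y - x) ≤ F y := by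
  have := deriv_le_of_forall_le_add_mul (a := F y - F x) (C := 0) (hasDerivAt_line hd (y - x))
    (fun t h0 h1 => by simpa using ConvexOn.le_segment hF hx hy h0.le h1)
  linarith

/-- Along the segment the gain is `t * (1 - t) * (c / 2) * ‖y - x‖ ^ 2`: its linear part sharpens
the slope, and its quadratic part is absorbed by `C`. -/
theorem StrongConvexOn.add_inner_gradient_le {S : Set (E n)} {c : ℝ} {F : E n → ℝ}
    (hF : StrongConvexOn S c F) {x y : E n} (hd : DifferentiableAt ℝ F x) (hx : x ∈ S)
    (hy : y ∈ S) :
    F x + inner ℝ (gradient F x) (y - x) + c / 2 * ‖y - x‖ ^ 2 ≤ F y := by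
  have := deriv_le_of_forall_le_add_mul (a := F y - F x - c / 2 * ‖y - x‖ ^ 2)
    (C := c / 2 * ‖y - x‖ ^ 2) (hasDerivAt_line hd (y - x)) (fun t h0 h1 => by
      have := hF.2 hx hy (sub_nonneg.2 h1) h0.le (by ring)
      have e : (1 - t) • x + t • y = x + t • (y - x) := by module
      rw [e, smul_eq_mul, smul_eq_mul, norm_sub_rev] at this
      simp only [zero_smul, add_zero]
      linarith)
  linarith

theorem inner_eq_sum (u v : E k) : inner ℝ u v = ∑ i, u i * v i := by
  simp [PiLp.inner_apply, mul_comm]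

theorem inner_jacT (G : E n → E k) (x : E n) (ξ : E k) (v : E n) :
    inner ℝ (jacT G x ξ) v = ∑ i, ξ i * inner ℝ (gradient (fun y => G y i) x) v := by
  simp [jacT, sum_inner, inner_smul_left]

theorem continuousOn_euclidean {α : Type*} [TopologicalSpace α] {s : Set α} {G : α → E k}
    (h : ∀ i, ContinuousOn (fun x => G x i) s) : ContinuousOn G s :=
  (PiLp.continuous_toLp 2 (fun _ : Fin k => ℝ)).comp_continuousOn (continuousOn_pi.2 h)

theorem convexOn_inner {K : Set (E n)} (hK : Convex ℝ K) {G : E n → E k}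
    (hG : ∀ i, ConvexOn ℝ K fun y => G y i) {ξ : E k} (hξ : ∀ i, 0 ≤ ξ i) :
    ConvexOn ℝ K fun y => inner ℝ ξ (G y) := by
  refine ⟨hK, fun x hx y hy a b ha hb hab => ?_⟩
  simp only [inner_eq_sum, smul_eq_mul, Finset.mul_sum]
  rw [← Finset.sum_add_distrib]
  refine Finset.sum_le_sum fun i _ => ?_
  have := (hG i).2 hx hy ha hb hab
  simp only [smul_eq_mul] at this
  nlinarith [mul_le_mul_of_nonneg_left this (hξ i)]

theorem inner_le_inner_of_le {ξ u v : E k} (hξ : ∀ i, 0 ≤ ξ i) (h : ∀ i, u i ≤ v i) :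
    inner ℝ ξ u ≤ inner ℝ ξ v := by
  simp only [inner_eq_sum]
  exact Finset.sum_le_sum fun i _ => mul_le_mul_of_nonneg_left (h i) (hξ i)

theorem inner_nonpos_of_nonneg_of_nonpos {ξ u : E k} (hξ : ∀ i, 0 ≤ ξ i) (h : ∀ i, u i ≤ 0) :
    inner ℝ ξ u ≤ 0 := by
  simpa using inner_le_inner_of_le (v := 0) hξ (by simpa using h)

theorem norm_apply_le (u : E k) (i : Fin k) : |u i| ≤ ‖u‖ := PiLp.norm_apply_le u i

theorem hasDerivAt_inner_line {G : E n → E k} {x : E n}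
    (hG : ∀ i, DifferentiableAt ℝ (fun y => G y i) x) (ξ : E k) (v : E n) :
    HasDerivAt (fun t : ℝ => inner ℝ ξ (G (x + t • v))) (inner ℝ (jacT G x ξ) v) 0 := by
  simp only [inner_eq_sum ξ, inner_jacT]
  exact HasDerivAt.fun_sum fun i _ => (hasDerivAt_line (hG i) v).const_mul (ξ i)

/-- Second-order upper bound from a Lipschitz gradient. -/
theorem exists_quadratic_bound {K : Set (E n)} (hc : IsCompact K) (hK : Convex ℝ K) {F : E n → ℝ}
    (hF : ∃ U : Set (E n), IsOpen U ∧ K ⊆ U ∧ C11On F U) :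
    ∃ L : ℝ, 0 ≤ L ∧ ∀ x ∈ K, ∀ y ∈ K,
      F y ≤ F x + inner ℝ (gradient F x) (y - x) + L * ‖y - x‖ ^ 2 := by
  obtain ⟨U, hU, hKU, hd, hl⟩ := hF
  obtain ⟨L, hL⟩ := (hl.mono hKU).exists_lipschitzOnWith_of_compact hc
  refine ⟨L, L.2, fun x hx y hy => ?_⟩
  have hseg : segment ℝ x y ⊆ K := hK.segment_subset hx hy
  -- On the segment the derivative varies by at most `L * ‖y - x‖`; the mean value inequality then
  -- costs a factor 2 against the sharp constant, which is harmless.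
  have := (convex_segment x y).norm_image_sub_le_of_norm_hasFDerivWithin_le' (f := F)
    (f' := fun z => fderiv ℝ F z) (φ := fderiv ℝ F x) (C := L * ‖y - x‖)
    (fun z hz => ((hd z (hKU (hseg hz))).differentiableAt
      (hU.mem_nhds (hKU (hseg hz)))).hasFDerivAt.hasFDerivWithinAt)
    (fun z hz => by
      rw [← toDual_gradient, ← toDual_gradient, ← map_sub, LinearIsometryEquiv.norm_map]
      refine (hL.norm_sub_le (hseg hz) hx).trans ?_
      refine mul_le_mul_of_nonneg_left ?_ L.2
      obtain ⟨t, ⟨h0, h1⟩, rfl⟩ := segment_eq_image' ℝ x y ▸ hz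
      rw [add_sub_cancel_left, norm_smul, Real.norm_of_nonneg h0]
      exact mul_le_of_le_one_left (norm_nonneg _) h1)
    (left_mem_segment ℝ x y) (right_mem_segment ℝ x y)
  rw [← inner_gradient_left] at this
  have := (abs_le.1 this).2
  nlinarith

theorem exists_common_quadratic_bound {ι : Type*} [Finite ι] {K : Set (E n)} (hc : IsCompact K)
    (hK : Convex ℝ K) {F : ι → E n → ℝ}
    (hF : ∃ U : Set (E n), IsOpen U ∧ K ⊆ U ∧ ∀ i, C11On (F i) U) :
    ∃ L : ℝ, 0 ≤ L ∧ ∀ i, ∀ x ∈ K, ∀ y ∈ K,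
      F i y ≤ F i x + inner ℝ (gradient (F i) x) (y - x) + L * ‖y - x‖ ^ 2 := by
  obtain ⟨U, hU, hKU, hF⟩ := hF
  cases nonempty_fintype ι
  choose L hL0 hL using fun i => exists_quadratic_bound hc hK ⟨U, hU, hKU, hF i⟩
  refine ⟨∑ i, L i, Finset.sum_nonneg fun i _ => hL0 i, fun i x hx y hy => ?_⟩
  refine (hL i x hx y hy).trans ?_
  have := Finset.single_le_sum (fun i _ => hL0 i) (Finset.mem_univ i)
  gcongr

/-! ### Lagrangian duality via a minimax theorem. -/

variable {m p : ℕ}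

/-- Strong Lagrangian duality with bounded multipliers. -/
theorem exists_bounded_multiplier {K : Set (E n)} (hKc : IsCompact K) (hK : Convex ℝ K)
    (hKn : K.Nonempty) {F : E n → ℝ} {G : E n → E m} {H : E n → E p} (hF : ConvexOn ℝ K F)
    (hFc : ContinuousOn F K) (hG : ∀ i, ConvexOn ℝ K fun y => G y i) (hGc : ContinuousOn G K)
    (hH : ∀ π, ConvexOn ℝ K fun y => inner ℝ π (H y)) (hHc : ContinuousOn H K) {R B : ℝ}
    (hR : 0 ≤ R) (hB : ∀ y ∈ K, ∀ z ∈ K, F y - F z ≤ B)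
    (hbd : ∀ μ : E m × E p, (∀ i, 0 ≤ μ.1 i) →
      (∀ y ∈ K, -B ≤ inner ℝ μ.1 (G y) + inner ℝ μ.2 (H y)) → ‖μ‖ ≤ R) :
    ∃ μ : E m × E p, (∀ i, 0 ≤ μ.1 i) ∧ ‖μ‖ ≤ R ∧ ∃ z ∈ K, (∀ i, G z i ≤ 0) ∧ H z = 0 ∧
      ∀ y ∈ K, F z ≤ F y + (inner ℝ μ.1 (G y) + inner ℝ μ.2 (H y)) := by
  let Φ : E n → E m × E p → ℝ := fun y μ => F y + (inner ℝ μ.1 (G y) + inner ℝ μ.2 (H y))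
  -- Truncation makes the multiplier set compact. The radius exceeds `R` by one so that a saddle
  -- multiplier, once bounded by `R`, can still be moved by any `ν` of norm at most one with `0 ≤
  -- ν.1 i`.
  let Y : Set (E m × E p) := {μ | ∀ i, 0 ≤ μ.1 i} ∩ Metric.closedBall 0 (R + 1)
  have hYpos : IsClosed {μ : E m × E p | ∀ i, 0 ≤ μ.1 i} := by
    simp only [Set.ofPred_forall]
    exact isClosed_iInter fun i => isClosed_le continuous_const (by fun_prop)
  have hYpos' : Convex ℝ {μ : E m × E p | ∀ i, 0 ≤ μ.1 i} := by
    intro μ hμ ν hν a b ha hb _ i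
    simpa using add_nonneg (mul_nonneg ha (hμ i)) (mul_nonneg hb (hν i))
  obtain ⟨z, hz, μ, hμ, hs⟩ := Sion.exists_isSaddlePointOn (X := K) (Y := Y) (f := Φ) hKn hK hKc
    (fun μ _ => ContinuousOn.lowerSemicontinuousOn (by
      exact hFc.add ((continuousOn_const.inner hGc).add (continuousOn_const.inner hHc))))
    (fun μ hμ => ConvexOn.quasiconvexOn (by
      exact hF.add ((convexOn_inner hK hG hμ.1).add (hH μ.2))))
    (hYpos'.inter (convex_closedBall _ _))
    ⟨0, by simp, by simpa using by linarith⟩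
    ((isCompact_closedBall _ _).inter_left hYpos)
    (fun y _ => Continuous.continuousOn (by fun_prop) |>.upperSemicontinuousOn)
    (fun y _ => ConcaveOn.quasiconcaveOn ⟨hYpos'.inter (convex_closedBall _ _),
      fun μ _ ν _ a b ha hb hab => by
        have : F y = a * F y + b * F y := by rw [← add_mul, hab, one_mul]
        simp only [Φ, Prod.fst_add, Prod.snd_add, Prod.smul_fst, Prod.smul_snd, inner_add_left,
          real_inner_smul_left, smul_eq_mul]
        linarith⟩)
  have h0 : (0 : E m × E p) ∈ Y := ⟨by simp, by simpa using by linarith⟩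
  have hFz : ∀ y ∈ K, F z ≤ Φ y μ := fun y hy => by simpa [Φ] using hs y hy 0 h0
  -- Comparison with the zero multiplier bounds the constraint part below by `F z - F y`, hence by
  -- `-B`.
  have hμR : ‖μ‖ ≤ R := hbd μ hμ.1 fun y hy => by
    have := hFz y hy
    have := hB y hy z hz
    simp only [Φ] at *
    linarith
  -- Maximality of `μ` on the truncated set: no admissible perturbation raises the Lagrangian at
  -- `z`. Coordinate vectors and the normalized `H z` then give primal feasibility.
  have hstep : ∀ ν : E m × E p, (∀ i, 0 ≤ ν.1 i) → ‖ν‖ ≤ 1 →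
      inner ℝ ν.1 (G z) + inner ℝ ν.2 (H z) ≤ 0 := fun ν hν hν1 => by
    have := hs z hz (μ + ν) ⟨fun i => add_nonneg (hμ.1 i) (hν i), by
      rw [mem_closedBall_zero_iff]; exact (norm_add_le _ _).trans (by linarith)⟩
    simp only [Φ, Prod.fst_add, Prod.snd_add, inner_add_left] at this
    linarith
  refine ⟨μ, hμ.1, hμR, z, hz, fun i => ?_, ?_, hFz⟩
  · simpa [EuclideanSpace.inner_single_left] using hstep (EuclideanSpace.single i 1, 0) (fun j => by
      by_cases h : j = i <;> simp [h]) (by simp [Prod.norm_def])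
  · by_contra hne
    have hpos : 0 < ‖H z‖ := norm_pos_iff.2 hne
    have := hstep (0, ‖H z‖⁻¹ • H z) (by simp) (by
      simp [Prod.norm_def, norm_smul, inv_mul_cancel₀ hpos.ne'])
    simp only [inner_zero_left, zero_add, real_inner_smul_left, real_inner_self_eq_norm_sq] at this
    have : 0 < ‖H z‖⁻¹ * ‖H z‖ ^ 2 := by positivity
    linarith

end GhostDSM

/-! ### Consequences of the assumptions, and the eMFCQ as a multiplier bound. -/

namespace GhostDSM

variable {n m p : ℕ} {P : Problem n m p}

namespace Problem

theorem Standing.differentiableAt_f (hP : P.Standing) {x : E n} (hx : x ∈ P.K) :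
    DifferentiableAt ℝ P.f x := by
  obtain ⟨U, hU, hKU, hf, -, -⟩ := hP.smooth
  exact (hf.1 x (hKU hx)).differentiableAt (hU.mem_nhds (hKU hx))

theorem Standing.differentiableAt_g (hP : P.Standing) {x : E n} (hx : x ∈ P.K) (i : Fin m) :
    DifferentiableAt ℝ (fun y => P.g y i) x := by
  obtain ⟨U, hU, hKU, -, hg, -⟩ := hP.smooth
  exact ((hg i).1 x (hKU hx)).differentiableAt (hU.mem_nhds (hKU hx))

theorem Standing.differentiableAt_h (hP : P.Standing) {x : E n} (hx : x ∈ P.K) (j : Fin p) :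
    DifferentiableAt ℝ (fun y => P.h y j) x := by
  obtain ⟨U, hU, hKU, -, -, hh⟩ := hP.smooth
  exact ((hh j).1 x (hKU hx)).differentiableAt (hU.mem_nhds (hKU hx))

theorem Standing.continuousOn_g (hP : P.Standing) : ContinuousOn P.g P.K :=
  continuousOn_euclidean fun i _ hx =>
    (hP.differentiableAt_g hx i).continuousAt.continuousWithinAt

theorem Standing.continuousOn_h (hP : P.Standing) : ContinuousOn P.h P.K :=
  continuousOn_euclidean fun j _ hx =>
    (hP.differentiableAt_h hx j).continuousAt.continuousWithinAt

theorem Standing.continuousOn_q (hP : P.Standing) : ContinuousOn P.q P.K := by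
  obtain ⟨U, -, hKU, hq⟩ := hP.q_lipschitz
  exact hq.continuousOn.mono hKU

theorem Standing.continuousOn_gradient_g (hP : P.Standing) (i : Fin m) :
    ContinuousOn (gradient fun y => P.g y i) P.K := by
  obtain ⟨U, -, hKU, -, hg, -⟩ := hP.smooth
  exact (hg i).2.continuousOn.mono hKU

variable {A : Matrix (Fin p) (Fin n) ℝ} {b : E p}

theorem AssumptionD.isCompact (hP : P.Standing) (hD : P.AssumptionD A b) : IsCompact P.K :=
  Metric.isCompact_of_isClosed_isBounded hP.closed hD.bounded

theorem AssumptionD.h_eq (hD : P.AssumptionD A b) {x : E n} (hx : x ∈ P.K) :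
    P.h x = A.toEuclideanLin x + b := by
  obtain ⟨V, -, hKV, -, hh⟩ := hD.convex_affine
  exact hh x (hKV hx)

theorem AssumptionD.convexOn_g (hP : P.Standing) (hD : P.AssumptionD A b) (i : Fin m) :
    ConvexOn ℝ P.K fun x => P.g x i := by
  obtain ⟨V, -, hKV, hg, -⟩ := hD.convex_affine
  exact (hg i).subset hKV hP.convex

theorem AssumptionD.g_add_inner_gradient_le (hP : P.Standing) (hD : P.AssumptionD A b) {x y : E n}
    (hx : x ∈ P.K) (hy : y ∈ P.K) (i : Fin m) :
    P.g x i + inner ℝ (gradient (fun z => P.g z i) x) (y - x) ≤ P.g y i :=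
  ConvexOn.add_inner_gradient_le (hD.convexOn_g hP i) (hP.differentiableAt_g hx i) hx hy

theorem AssumptionD.h_segment (hP : P.Standing) (hD : P.AssumptionD A b) {x y : E n}
    (hx : x ∈ P.K) (hy : y ∈ P.K) {t : ℝ} (h0 : 0 ≤ t) (h1 : t ≤ 1) :
    P.h (x + t • (y - x)) = P.h x + t • (P.h y - P.h x) := by
  rw [hD.h_eq (segment_mem hP.convex hx hy h0 h1), hD.h_eq hx, hD.h_eq hy, map_add, map_smul,
    map_sub]
  module

theorem AssumptionD.convexOn_inner_h (hP : P.Standing) (hD : P.AssumptionD A b) (π : E p) :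
    ConvexOn ℝ P.K fun y => inner ℝ π (P.h y) := by
  refine ⟨hP.convex, fun x hx y hy a c ha hc hac => le_of_eq ?_⟩
  have hz := hP.convex hx hy ha hc hac
  dsimp only
  obtain rfl : a = 1 - c := by linarith
  rw [hD.h_eq hx, hD.h_eq hy, hD.h_eq hz]
  simp only [map_add, map_smul, smul_eq_mul, inner_add_right, real_inner_smul_right]
  ring

/-- Along a segment of `K` the map `h` is exactly affine, so the upper and lower derivative
estimates coincide. -/
theorem AssumptionD.inner_jacT_h (hP : P.Standing) (hD : P.AssumptionD A b) {x y : E n}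
    (hx : x ∈ P.K) (hy : y ∈ P.K) (π : E p) :
    inner ℝ (jacT P.h x π) (y - x) = inner ℝ π (P.h y - P.h x) := by
  have h1 := hasDerivAt_inner_line (hP.differentiableAt_h hx) π (y - x)
  have key : ∀ t : ℝ, 0 < t → t ≤ 1 → inner ℝ π (P.h (x + t • (y - x))) =
      inner ℝ π (P.h (x + (0 : ℝ) • (y - x))) + t * inner ℝ π (P.h y - P.h x) + t ^ 2 * 0 := by
    intro t h0 h1
    rw [hD.h_segment hP hx hy h0.le h1, inner_add_right, real_inner_smul_right]
    simp
  exact le_antisymm (deriv_le_of_forall_le_add_mul h1 fun t h0 h1 => (key t h0 h1).le)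
    (le_deriv_of_forall_add_mul_le h1 fun t h0 h1 => (key t h0 h1).ge)

theorem viol_eq_zero {x : E n} (hx : x ∈ P.feasible) : P.viol x = 0 := by
  have h1 : ∀ i, max (P.g x i) 0 = 0 := fun i => max_eq_right (hx.1 i)
  simp [viol, h1, hx.2.1]

theorem mem_normalCone_nonposOrthant {k : ℕ} {ξ u : E k} (hξ : ∀ i, 0 ≤ ξ i) (hu : ∀ i, u i ≤ 0)
    (h : 0 ≤ inner ℝ ξ u) : ξ ∈ normalCone (nonposOrthant k) u := by
  refine ⟨hu, fun y hy => ?_⟩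
  rw [inner_sub_right]
  linarith [inner_nonpos_of_nonneg_of_nonpos hξ hy]

/-- At a feasible point the eMFCQ excludes multipliers for which the constraint part of the
Lagrangian is nonnegative on `K`. -/
theorem EMFCQ.eq_zero (hP : P.Standing) {x : E n}
    (hx : x ∈ P.feasible) (hcq : P.EMFCQ x) {μ : E m × E p} (hμ : ∀ i, 0 ≤ μ.1 i)
    (h : ∀ y ∈ P.K, 0 ≤ inner ℝ μ.1 (P.g y) + inner ℝ μ.2 (P.h y)) : μ = 0 := by
  have hxK := hx.2.2
  have hg0 : 0 ≤ inner ℝ μ.1 (P.g x) := by simpa [hx.2.1] using h x hxK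
  have hg0' : inner ℝ μ.1 (P.g x) = 0 :=
    le_antisymm (inner_nonpos_of_nonneg_of_nonpos hμ hx.1) hg0
  suffices hmem : μ ∈ P.M0 x by
    rw [show P.M0 x = {0} from hcq] at hmem
    exact hmem
  -- The constraint part vanishes at `x` and is nonnegative on `K`, so `x` minimizes it over `K` and
  -- its negative gradient is normal to `K`.
  refine ⟨?_, ?_, -(jacT P.g x μ.1 + jacT P.h x μ.2), ⟨hxK, fun y hy => ?_⟩, add_neg_cancel _⟩
  · simp only [viol_eq_zero hx, sub_zero]
    exact mem_normalCone_nonposOrthant hμ hx.1 hg0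
  · rw [viol_eq_zero hx, hx.2.1]
    refine ⟨fun j => by simp, fun y hy => ?_⟩
    have : y = 0 := by ext j; simpa using hy j
    simp [this]
  · rw [inner_neg_left, inner_add_left, neg_nonpos]
    refine le_deriv_of_forall_add_mul_le (C := 0)
      ((hasDerivAt_inner_line (hP.differentiableAt_g hxK) μ.1 (y - x)).add
        (hasDerivAt_inner_line (hP.differentiableAt_h hxK) μ.2 (y - x))) fun t h0 h1 => ?_
    have := h _ (segment_mem hP.convex hxK hy h0.le h1)
    simpa [hx.2.1, hg0'] using this

/-- If no constant works, normalized counterexamples cluster at a unit multiplier whose constraint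
part is nonnegative on `K`, which the eMFCQ forbids. Linearity in `C` comes from the homogeneity in
`μ`. -/
theorem exists_multiplier_norm_le (hP : P.Standing) (hD : P.AssumptionD A b) :
    ∃ M : ℝ, 0 < M ∧ ∀ C : ℝ, 0 ≤ C → ∀ μ : E m × E p, (∀ i, 0 ≤ μ.1 i) →
      (∀ y ∈ P.K, -C ≤ inner ℝ μ.1 (P.g y) + inner ℝ μ.2 (P.h y)) → ‖μ‖ ≤ M * C := by
  by_contra! hcon
  choose C hC μ hμ hμK hlt using fun k : ℕ => hcon (k + 1) (by positivity)
  have hpos : ∀ k, 0 < ‖μ k‖ := fun k => lt_of_le_of_lt (by have := hC k; positivity) (hlt k)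
  have hu : ∀ k, ‖μ k‖⁻¹ • μ k ∈ Metric.sphere (0 : E m × E p) 1 := fun k => by
    rw [mem_sphere_zero_iff_norm, norm_smul, norm_inv, norm_norm, inv_mul_cancel₀ (hpos k).ne']
  obtain ⟨u, hu1, φ, hφ, hlim⟩ := (isCompact_sphere (0 : E m × E p) 1).tendsto_subseq hu
  obtain ⟨x, hx⟩ := hD.feasible_nonempty
  have hz : u = 0 := by
    refine EMFCQ.eq_zero hP hx (hD.emfcq x hx.2.2) (fun i => ?_) fun y hy => ?_
    · have : Tendsto (fun k => (‖μ (φ k)‖⁻¹ • μ (φ k)).1 i) atTop (𝓝 (u.1 i)) :=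
        ((by fun_prop : Continuous fun v : E m × E p => v.1 i).tendsto u).comp hlim
      exact ge_of_tendsto' this fun k =>
        mul_nonneg (inv_nonneg.2 (norm_nonneg _)) (hμ (φ k) i)
    · have h1 : Tendsto (fun k => inner ℝ (‖μ (φ k)‖⁻¹ • μ (φ k)).1 (P.g y) +
          inner ℝ (‖μ (φ k)‖⁻¹ • μ (φ k)).2 (P.h y)) atTop
          (𝓝 (inner ℝ u.1 (P.g y) + inner ℝ u.2 (P.h y))) :=
        ((by fun_prop : Continuous fun v : E m × E p =>
          inner ℝ v.1 (P.g y) + inner ℝ v.2 (P.h y)).tendsto u).comp hlim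
      have h2 : Tendsto (fun k => -(1 / ((φ k : ℝ) + 1))) atTop (𝓝 0) := by
        simpa using (tendsto_one_div_add_atTop_nhds_zero_nat (𝕜 := ℝ)).comp hφ.tendsto_atTop |>.neg
      refine le_of_tendsto_of_tendsto' h2 h1 fun k => ?_
      simp only [Prod.smul_fst, Prod.smul_snd, real_inner_smul_left]
      rw [← mul_add, ← div_eq_inv_mul, le_div_iff₀ (hpos _)]
      refine le_trans ?_ (hμK (φ k) y hy)
      have := hlt (φ k)
      rw [neg_mul, neg_le_neg_iff, one_div, ← div_eq_inv_mul, le_div_iff₀ (by positivity)]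
      linarith
  rw [hz] at hu1
  simp at hu1

end Problem

end GhostDSM

/-! ### The subproblems: solvability and uniform multipliers. -/

namespace GhostDSM

variable {n m p : ℕ} {P : Problem n m p}

namespace Problem

variable {A : Matrix (Fin p) (Fin n) ℝ} {b : E p} {ft : E n → E n → ℝ} {β : ℝ}
  {Od Ox : Set (E n)}

theorem AssumptionA.sub_mem (hA : P.AssumptionA ft β Od Ox)
    (hβK : ∀ x ∈ P.K, ∀ y ∈ P.K, ∀ i, |x i - y i| ≤ β) {x y : E n} (hx : x ∈ P.K)
    (hy : y ∈ P.K) : y - x ∈ Od :=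
  hA.ball_subset fun i => by simpa using hβK y hy x hx i

theorem AssumptionA.zero_mem (hA : P.AssumptionA ft β Od Ox) (hβ : 0 < β) : (0 : E n) ∈ Od :=
  hA.ball_subset fun i => by simpa using hβ.le

theorem AssumptionA.differentiableAt_zero (hA : P.AssumptionA ft β Od Ox) (hβ : 0 < β) {x : E n}
    (hx : x ∈ P.K) : DifferentiableAt ℝ (fun d => ft d x) 0 :=
  ((hA.contDiff x (hA.K_subset hx)).differentiableOn one_ne_zero).differentiableAt
    (hA.Od_open.mem_nhds (hA.zero_mem hβ))

theorem AssumptionA.continuousOn_objective (hP : P.Standing) (hA : P.AssumptionA ft β Od Ox)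
    (hβK : ∀ x ∈ P.K, ∀ y ∈ P.K, ∀ i, |x i - y i| ≤ β) :
    ContinuousOn (fun z : E n × E n => ft (z.2 - z.1) z.1 + P.q z.2) (P.K ×ˢ P.K) := by
  refine ContinuousOn.add ?_ ?_
  · exact hA.cont.comp (f := fun z : E n × E n => (z.2 - z.1, z.1)) (by fun_prop)
      fun z hz => ⟨hA.sub_mem hβK hz.1 hz.2, hA.K_subset hz.1⟩
  · exact hP.continuousOn_q.comp continuousOn_snd fun z hz => hz.2

theorem AssumptionA.continuousOn_objective_right (hP : P.Standing)
    (hA : P.AssumptionA ft β Od Ox)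
    (hβK : ∀ x ∈ P.K, ∀ y ∈ P.K, ∀ i, |x i - y i| ≤ β) {x : E n} (hx : x ∈ P.K) :
    ContinuousOn (fun y => ft (y - x) x + P.q y) P.K :=
  (hA.continuousOn_objective hP hβK).comp (f := fun y => (x, y)) (by fun_prop)
    fun _ hy => ⟨hx, hy⟩

/-- Compactness is applied to `K ×ˢ K`, base point included, so that `B`, and with it the multiplier
radius, is independent of `x`. -/
theorem AssumptionA.exists_oscillation_bound (hP : P.Standing) (hA : P.AssumptionA ft β Od Ox)
    (hβK : ∀ x ∈ P.K, ∀ y ∈ P.K, ∀ i, |x i - y i| ≤ β) (hc : IsCompact P.K) :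
    ∃ B : ℝ, 0 ≤ B ∧ ∀ x ∈ P.K, ∀ y ∈ P.K, ∀ z ∈ P.K,
      (ft (y - x) x + P.q y) - (ft (z - x) x + P.q z) ≤ B := by
  obtain ⟨C, hC⟩ := (hc.prod hc).exists_bound_of_continuousOn (hA.continuousOn_objective hP hβK)
  have hC' : ∀ x ∈ P.K, ∀ y ∈ P.K, |ft (y - x) x + P.q y| ≤ C := fun x hx y hy =>
    hC (x, y) ⟨hx, hy⟩
  obtain ⟨w, hw⟩ := hP.nonempty
  refine ⟨2 * C, by linarith [(abs_nonneg _).trans (hC' w hw w hw)], fun x hx y hy z hz => ?_⟩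
  linarith [(abs_le.1 (hC' x hx y hy)).2, (abs_le.1 (hC' x hx z hz)).1]

/-- The subproblem objective is strictly convex in the direction. -/
theorem AssumptionA.strictConvexOn (hP : P.Standing) (hA : P.AssumptionA ft β Od Ox)
    {S : Set (E n)} (hS : Convex ℝ S) (hSO : S ⊆ Od) {x : E n} (hx : x ∈ P.K)
    (hSK : ∀ d ∈ S, x + d ∈ P.K) : StrictConvexOn ℝ S fun d => ft d x + P.q (x + d) := by
  obtain ⟨c, hc, hsc⟩ := hA.strongConvex
  exact (((hsc x hx).strictConvexOn hc).subset hSO hS).add_convexOn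
    ((hP.q_convex.translate_right x).subset hSK hS)

theorem AssumptionA.convexOn_objective (hP : P.Standing) (hA : P.AssumptionA ft β Od Ox)
    (hβK : ∀ x ∈ P.K, ∀ y ∈ P.K, ∀ i, |x i - y i| ≤ β) {x : E n} (hx : x ∈ P.K) :
    ConvexOn ℝ P.K fun y => ft (y - x) x + P.q y := by
  obtain ⟨c, hc, hsc⟩ := hA.strongConvex
  refine ConvexOn.add ?_ hP.q_convex
  have h := ((hsc x hx).strictConvexOn hc).convexOn.translate_left (-x)
  refine ConvexOn.congr (h.subset (fun y hy => ?_) hP.convex) fun y _ => ?_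
  · simpa [neg_add_eq_sub] using hA.sub_mem hβK hx hy
  · simp [← sub_eq_add_neg]

variable (P) in
/-- The linearization of the inequality constraints at `x`. -/
noncomputable def linearization (x y : E n) : E m :=
  WithLp.toLp 2 fun i => P.g x i + inner ℝ (gradient (fun z => P.g z i) x) (y - x)

theorem inner_linearization (x y : E n) (ξ : E m) :
    inner ℝ ξ (P.linearization x y) =
      inner ℝ ξ (P.g x) + inner ℝ (jacT P.g x ξ) (y - x) := by
  simp only [inner_eq_sum ξ, inner_jacT, linearization, mul_add, Finset.sum_add_distrib]

theorem continuous_linearization (x : E n) : Continuous (P.linearization x) :=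
  (PiLp.continuous_toLp 2 (fun _ : Fin m => ℝ)).comp (continuous_pi fun i => by fun_prop)

theorem AssumptionD.sub_mem_subFeasible_iff (hD : P.AssumptionD A b) {x y : E n} :
    y - x ∈ P.subFeasible A b x ↔ (∀ i, P.linearization x y i ≤ 0) ∧ P.h y = 0 ∧ y ∈ P.K := by
  simp only [subFeasible, mem_ofPred_eq, add_sub_cancel, linearization]
  refine and_congr_right fun _ => and_congr_left fun hy => ?_
  rw [hD.h_eq hy]

/-- Linearization underestimates a convex constraint, so a feasible point of the problem is
reachable in every subproblem; this is why none of them is infeasible. -/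
theorem AssumptionD.sub_mem_subFeasible (hP : P.Standing) (hD : P.AssumptionD A b) {x y : E n}
    (hx : x ∈ P.K) (hy : y ∈ P.feasible) : y - x ∈ P.subFeasible A b x :=
  hD.sub_mem_subFeasible_iff.2 ⟨fun i =>
    (hD.g_add_inner_gradient_le hP hx hy.2.2 i).trans (hy.1 i), hy.2⟩

theorem convex_subFeasible (hP : P.Standing) (x : E n) : Convex ℝ (P.subFeasible A b x) := by
  intro d hd e he s t hs ht hst
  have hcomb : x + (s • d + t • e) = s • (x + d) + t • (x + e) := by
    obtain rfl : s = 1 - t := by linarith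
    module
  refine ⟨fun i => ?_, ?_, ?_⟩
  · have h1 := mul_nonpos_of_nonneg_of_nonpos hs (hd.1 i)
    have h2 := mul_nonpos_of_nonneg_of_nonpos ht (he.1 i)
    rw [inner_add_right, real_inner_smul_right, real_inner_smul_right]
    obtain rfl : s = 1 - t := by linarith
    linarith
  · have h1 := congrArg (fun v => s • v) hd.2.1
    have h2 := congrArg (fun v => t • v) he.2.1
    simp only [smul_zero] at h1 h2
    rw [hcomb, map_add, map_smul, map_smul]
    have : b = s • b + t • b := by rw [← add_smul, hst, one_smul]
    rw [this]
    calc _ = s • (A.toEuclideanLin (x + d) + b) + t • (A.toEuclideanLin (x + e) + b) := by module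
      _ = 0 := by rw [h1, h2, add_zero]
  · rw [hcomb]
    exact hP.convex hd.2.2 he.2.2 hs ht hst

theorem isCompact_subFeasible (hc : IsCompact P.K) (x : E n) :
    IsCompact (P.subFeasible A b x) := by
  have hK : IsCompact ((fun d => x + d) ⁻¹' P.K) := (Homeomorph.addLeft x).isCompact_preimage.2 hc
  refine hK.of_isClosed_subset ?_ fun d hd => hd.2.2
  have hlin : Continuous fun v : E n => A.toEuclideanLin v :=
    LinearMap.continuous_of_finiteDimensional _
  refine IsClosed.inter
    (s₁ := {d : E n | ∀ i, P.g x i + inner ℝ (gradient (fun y => P.g y i) x) d ≤ 0}) ?_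
    (IsClosed.inter (s₁ := {d : E n | A.toEuclideanLin (x + d) + b = 0}) ?_ hK.isClosed)
  · simp only [Set.ofPred_forall]
    exact isClosed_iInter fun i => isClosed_le (by fun_prop) continuous_const
  · exact isClosed_eq ((hlin.comp (by fun_prop)).add continuous_const) continuous_const

theorem existsUnique_isDirection (hP : P.Standing) (hA : P.AssumptionA ft β Od Ox)
    (hβK : ∀ x ∈ P.K, ∀ y ∈ P.K, ∀ i, |x i - y i| ≤ β) (hD : P.AssumptionD A b) {x : E n}
    (hx : x ∈ P.K) : ∃! d, P.IsDirection A b ft x d := by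
  have hSO : P.subFeasible A b x ⊆ Od := fun d hd => by
    simpa using hA.sub_mem hβK hx hd.2.2
  have hcont : ContinuousOn (fun d => ft d x + P.q (x + d)) (P.subFeasible A b x) := by
    have := (hA.continuousOn_objective_right hP hβK hx).comp (f := fun d => x + d)
      (s := P.subFeasible A b x) (by fun_prop) fun d hd => hd.2.2
    simpa [Function.comp_def] using this
  obtain ⟨y, hy⟩ := hD.feasible_nonempty
  obtain ⟨d, hd, hmin⟩ := (isCompact_subFeasible (hD.isCompact hP) x).exists_isMinOn
    ⟨_, hD.sub_mem_subFeasible hP hx hy⟩ hcont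
  refine ⟨d, ⟨hd, hmin⟩, fun e he => ?_⟩
  exact (hA.strictConvexOn hP (convex_subFeasible hP x) hSO hx fun d hd => hd.2.2).eq_of_isMinOn
    he.2 hmin he.1 hd

/-- Uniformly bounded multipliers for the subproblems. -/
theorem exists_direction_multiplier (hP : P.Standing) (hA : P.AssumptionA ft β Od Ox)
    (hβK : ∀ x ∈ P.K, ∀ y ∈ P.K, ∀ i, |x i - y i| ≤ β) (hD : P.AssumptionD A b) :
    ∃ R : ℝ, 0 ≤ R ∧ ∀ x ∈ P.K, ∀ d, P.IsDirection A b ft x d →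
      ∃ μ : E m × E p, (∀ i, 0 ≤ μ.1 i) ∧ ‖μ‖ ≤ R ∧ ∀ y ∈ P.K,
        ft d x + P.q (x + d) ≤ ft (y - x) x + P.q y +
          (inner ℝ μ.1 (P.g x) + inner ℝ (jacT P.g x μ.1) (y - x) + inner ℝ μ.2 (P.h y)) := by
  have hc := hD.isCompact hP
  obtain ⟨M, hM, hMb⟩ := exists_multiplier_norm_le hP hD
  obtain ⟨B, hB0, hB⟩ := hA.exists_oscillation_bound hP hβK hc
  refine ⟨M * B, by positivity, fun x hx d hd => ?_⟩
  obtain ⟨μ, hμ, hμR, z, hz, hGz, hHz, hmin⟩ := exists_bounded_multiplier hc hP.convex hP.nonempty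
    (G := P.linearization x) (H := P.h) (hA.convexOn_objective hP hβK hx)
    (hA.continuousOn_objective_right hP hβK hx)
    (fun i => by
      refine ConvexOn.congr (f := fun y => inner ℝ (gradient (fun z => P.g z i) x) y +
        (P.g x i - inner ℝ (gradient (fun z => P.g z i) x) x)) ?_ fun y _ => ?_
      · exact ((innerₗ (E n) (gradient (fun z => P.g z i) x)).convexOn hP.convex).add_const _
      · simp only [linearization, inner_sub_right]; ring)
    (continuous_linearization x).continuousOn (hD.convexOn_inner_h hP) hP.continuousOn_h
    (R := M * B) (by positivity) (fun y hy z hz => hB x hx y hy z hz)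
    -- A lower bound with the linearization at `x` is also one with `g`, since `μ.1` has nonnegative
    -- entries; this makes the radius uniform in `x`.
    (fun μ hμ h => hMb B hB0 μ hμ fun y hy => (h y hy).trans (add_le_add_left
      (inner_le_inner_of_le hμ fun i => hD.g_add_inner_gradient_le hP hx hy i) _))
  refine ⟨μ, hμ, hμR, fun y hy => ?_⟩
  -- The primal saddle point is feasible for the subproblem, so `d` does at least as well and
  -- inherits the saddle inequality.
  have h1 := hd.2 (hD.sub_mem_subFeasible_iff.2 ⟨hGz, hHz, hz⟩)
  simp only [add_sub_cancel, mem_ofPred_eq] at h1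
  have h2 := hmin y hy
  rw [inner_linearization] at h2
  linarith

end Problem

end GhostDSM

/-! ### The abstract descent argument. -/

namespace GhostDSM

/-- A merit-function argument: a sequence with divergent total stepsize cannot cluster at a point
near which the directions stay away from zero. -/
theorem not_mapClusterPt_of_descent {n : ℕ} {x d : ℕ → E n} {γ W : ℕ → ℝ} {c L w η r : ℝ} {z : E n}
    (hγ : Problem.IsStepsize γ) (hc : 0 < c) (hη : 0 < η) (hr : 0 < r)
    (hstep : ∀ ν, x (ν + 1) = x ν + γ ν • d ν)
    (hW : ∀ ν, W (ν + 1) ≤ W ν - γ ν * (c - L * γ ν) * ‖d ν‖ ^ 2) (hw : ∀ ν, w ≤ W ν)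
    (hd : ∀ ν, dist (x ν) z < r → η ≤ ‖d ν‖) : ¬ MapClusterPt z atTop x := by
  intro hz
  have hsmall : ∀ᶠ ν in atTop, L * γ ν < c / 2 := by
    have : Tendsto (fun ν => L * γ ν) atTop (𝓝 (L * 0)) := hγ.tendsto_zero.const_mul L
    exact this.eventually_lt_const (by rw [mul_zero]; positivity)
  obtain ⟨N, hN⟩ := eventually_atTop.1 hsmall
  have hdesc : ∀ ν, N ≤ ν → c / 2 * (γ ν * ‖d ν‖ ^ 2) ≤ W ν - W (ν + 1) := fun ν hν => by
    have h1 := hW ν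
    have h2 : γ ν * ‖d ν‖ ^ 2 * (c / 2) ≤ γ ν * ‖d ν‖ ^ 2 * (c - L * γ ν) :=
      mul_le_mul_of_nonneg_left (by linarith [hN ν hν])
        (mul_nonneg (hγ.pos ν).le (sq_nonneg _))
    linarith
  have hanti : Antitone fun ν => W (ν + N) := antitone_nat_of_succ_le fun ν => by
    have h1 := hdesc (ν + N) (by omega)
    have h2 : 0 ≤ c / 2 * (γ (ν + N) * ‖d (ν + N)‖ ^ 2) :=
      mul_nonneg (by positivity) (mul_nonneg (hγ.pos _).le (sq_nonneg _))
    rw [show ν + 1 + N = ν + N + 1 by ring]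
    linarith
  have hbdd : BddBelow (range fun ν => W (ν + N)) := ⟨w, by rintro _ ⟨ν, rfl⟩; exact hw _⟩
  set l := ⨅ ν, W (ν + N)
  have hlim : Tendsto W atTop (𝓝 l) :=
    (tendsto_add_atTop_iff_nat N).1 (tendsto_atTop_ciInf hanti hbdd)
  have hl : ∀ ν, N ≤ ν → l ≤ W ν := fun ν hν => by
    simpa [Nat.sub_add_cancel hν] using ciInf_le hbdd (ν - N)
  -- This is the merit decrease that travelling a distance `r / 2` with directions of norm at least
  -- `η` would cost. Starting within `r / 2` of `z` with less than this left above the limit, the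
  -- iterates cannot leave the ball of radius `r`.
  have hε : 0 < c / 2 * η * (r / 2) := by positivity
  obtain ⟨a, haz, haN, haW⟩ :=
    ((hz.frequently (Metric.ball_mem_nhds z (half_pos hr))).and_eventually
      ((eventually_ge_atTop N).and
        (hlim.eventually_lt_const (lt_add_of_pos_right l hε)))).exists
  -- The decrease pays both for the displacement and for the accumulated stepsize. The first
  -- estimate keeps the iterate near `z`, where `η ≤ ‖d ν‖` permits the next induction step; the
  -- second contradicts divergence.
  have hinv : ∀ k, c / 2 * η * ‖x (a + k) - x a‖ ≤ W a - W (a + k) ∧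
      c / 2 * η ^ 2 * (∑ ν ∈ Finset.range (a + k), γ ν - ∑ ν ∈ Finset.range a, γ ν) ≤
        W a - W (a + k) := by
    intro k
    induction k with
    | zero => simp
    | succ k ih =>
      have hk : dist (x (a + k)) z < r := by
        have h1 : c / 2 * η * ‖x (a + k) - x a‖ < c / 2 * η * (r / 2) := by
          linarith [ih.1, hl (a + k) (by omega)]
        have h2 := lt_of_mul_lt_mul_left h1 (by positivity)
        rw [← dist_eq_norm] at h2
        have h3 : dist (x a) z < r / 2 := haz
        linarith [dist_triangle (x (a + k)) (x a) z]
      have hdk := hd _ hk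
      have hγk := (hγ.pos (a + k)).le
      have hdk' := hdesc (a + k) (by omega)
      rw [← add_assoc]
      constructor
      · have h1 : ‖x (a + k + 1) - x a‖ ≤ ‖x (a + k) - x a‖ + γ (a + k) * ‖d (a + k)‖ := by
          rw [hstep, add_sub_right_comm]
          refine (norm_add_le _ _).trans_eq ?_
          rw [norm_smul, Real.norm_of_nonneg hγk]
        have h2 : η * (γ (a + k) * ‖d (a + k)‖) ≤ γ (a + k) * ‖d (a + k)‖ ^ 2 := by
          nlinarith [mul_le_mul_of_nonneg_left hdk (mul_nonneg hγk (norm_nonneg (d (a + k))))]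
        have h3 := mul_le_mul_of_nonneg_left h1 (show 0 ≤ c / 2 * η by positivity)
        have h4 := mul_le_mul_of_nonneg_left h2 (half_pos hc).le
        linarith [ih.1]
      · rw [Finset.sum_range_succ]
        have h2 : γ (a + k) * η ^ 2 ≤ γ (a + k) * ‖d (a + k)‖ ^ 2 := by gcongr
        have h4 := mul_le_mul_of_nonneg_left h2 (half_pos hc).le
        linarith [ih.2]
  -- The extra `1` would force the merit value below its limit `l`.
  obtain ⟨b, hab, hb⟩ := ((eventually_ge_atTop a).and (hγ.sum_diverges.eventually_ge_atTop
    (∑ ν ∈ Finset.range a, γ ν + (W a - l + 1) / (c / 2 * η ^ 2)))).exists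
  obtain ⟨k, rfl⟩ := Nat.exists_eq_add_of_le hab
  have h1 := (hinv k).2
  have h2 := hl (a + k) (by omega)
  rw [← le_sub_iff_add_le', div_le_iff₀' (by positivity)] at hb
  linarith

/-! ### Penalty descent, passage to the limit, convergence. -/

variable {n m p : ℕ} {P : Problem n m p}

namespace Problem

variable {A : Matrix (Fin p) (Fin n) ℝ} {b : E p} {ft : E n → E n → ℝ} {β : ℝ}
  {Od Ox : Set (E n)}

variable (P) in
/-- The `ℓ¹` penalty function with parameter `R`. -/
noncomputable def merit (R : ℝ) (x : E n) : ℝ :=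
  P.f x + P.q x + R * (∑ i, max (P.g x i) 0 + ∑ j, |P.h x j|)

theorem Standing.continuousOn_merit (hP : P.Standing) (R : ℝ) :
    ContinuousOn (P.merit R) P.K := by
  have hf : ContinuousOn P.f P.K := fun x hx =>
    (hP.differentiableAt_f hx).continuousAt.continuousWithinAt
  have hq := hP.continuousOn_q
  have hg := hP.continuousOn_g
  have hh := hP.continuousOn_h
  unfold merit
  fun_prop

theorem inner_add_inner_le_penalty {μ : E m × E p} {R : ℝ} (hμ : ∀ i, 0 ≤ μ.1 i)
    (hR : ‖μ‖ ≤ R) (u : E m) (w : E p) :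
    inner ℝ μ.1 u + inner ℝ μ.2 w ≤ R * (∑ i, max (u i) 0 + ∑ j, |w j|) := by
  rw [inner_eq_sum, inner_eq_sum, mul_add, Finset.mul_sum, Finset.mul_sum]
  refine add_le_add (Finset.sum_le_sum fun i _ => ?_) (Finset.sum_le_sum fun j _ => ?_)
  · refine (mul_le_mul_of_nonneg_left (le_max_left _ 0) (hμ i)).trans
      (mul_le_mul_of_nonneg_right ?_ (le_max_right _ _))
    exact ((le_abs_self _).trans (norm_apply_le _ i)).trans ((norm_fst_le μ).trans hR)
  · refine (le_abs_self _).trans ?_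
    rw [abs_mul]
    exact mul_le_mul_of_nonneg_right
      ((norm_apply_le _ j).trans ((norm_snd_le μ).trans hR)) (abs_nonneg _)

/-- The saddle inequality tested at `y = x` bounds the model change by `R` times the `ℓ¹` violation.
A step `t` shrinks that violation by the factor `1 - t` up to `O(t ^ 2)`, which cancels this term
and leaves the strong convexity gain. -/
theorem exists_merit_descent (hP : P.Standing) (hβ : 0 < β) (hA : P.AssumptionA ft β Od Ox)
    (hβK : ∀ x ∈ P.K, ∀ y ∈ P.K, ∀ i, |x i - y i| ≤ β) (hD : P.AssumptionD A b) :
    ∃ R c L : ℝ, 0 < c ∧ ∀ x ∈ P.K, ∀ d, P.IsDirection A b ft x d → ∀ t : ℝ, 0 ≤ t → t ≤ 1 →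
      P.merit R (x + t • d) ≤ P.merit R x - t * (c - L * t) * ‖d‖ ^ 2 := by
  have hKc := hD.isCompact hP
  obtain ⟨R, hR, hmul⟩ := exists_direction_multiplier hP hA hβK hD
  obtain ⟨c, hc, hsc⟩ := hA.strongConvex
  obtain ⟨U, hU, hKU, hf, hg, -⟩ := hP.smooth
  obtain ⟨L₁, -, hL₁⟩ := exists_quadratic_bound hKc hP.convex ⟨U, hU, hKU, hf⟩
  obtain ⟨L₂, hL₂0, hL₂⟩ := exists_common_quadratic_bound hKc hP.convex ⟨U, hU, hKU, hg⟩
  refine ⟨R, c / 2, L₁ + R * (m * L₂), half_pos hc, fun x hx d hd t h0 h1 => ?_⟩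
  have hxd : x + d ∈ P.K := hd.1.2.2
  have hxt : x + t • d ∈ P.K := by
    simpa using segment_mem hP.convex hx hxd h0 h1
  obtain ⟨μ, hμ, hμR, hmin⟩ := hmul x hx d hd
  have hmin := hmin x hx
  rw [sub_self, inner_zero_right, add_zero] at hmin
  have hpen := inner_add_inner_le_penalty hμ hμR (P.g x) (P.h x)
  have hdO : d ∈ Od := by simpa using hA.sub_mem hβK hx hxd
  have hstrong := StrongConvexOn.add_inner_gradient_le (hsc x hx)
    (hA.differentiableAt_zero hβ hx) (hA.zero_mem hβ) hdO
  rw [hA.grad_zero x hx, sub_zero] at hstrong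
  have hf' := hL₁ x hx _ hxt
  have hq' : P.q (x + t • d) ≤ P.q x + t * (P.q (x + d) - P.q x) := by
    simpa using ConvexOn.le_segment hP.q_convex hx hxd h0 h1
  have hg' : ∑ i, max (P.g (x + t • d) i) 0 ≤
      (1 - t) * ∑ i, max (P.g x i) 0 + m * L₂ * (t ^ 2 * ‖d‖ ^ 2) := by
    have : (1 - t) * ∑ i, max (P.g x i) 0 + m * L₂ * (t ^ 2 * ‖d‖ ^ 2) =
        ∑ i, ((1 - t) * max (P.g x i) 0 + L₂ * (t ^ 2 * ‖d‖ ^ 2)) := by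
      rw [Finset.sum_add_distrib, Finset.mul_sum]
      simp [mul_assoc]
    rw [this]
    refine Finset.sum_le_sum fun i _ => max_le ?_ ?_
    · have h2 := hL₂ i x hx _ hxt
      rw [add_sub_cancel_left, real_inner_smul_right, norm_smul, Real.norm_of_nonneg h0,
        mul_pow] at h2
      have h3 := mul_le_mul_of_nonneg_left (hd.1.1 i) h0
      have h4 := mul_le_mul_of_nonneg_left (le_max_left (P.g x i) 0) (sub_nonneg.2 h1)
      linarith
    -- The bound must also dominate `0`, which needs `t ≤ 1`.
    · exact add_nonneg (mul_nonneg (sub_nonneg.2 h1) (le_max_right _ _)) (by positivity)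
  have hh' : ∑ j, |P.h (x + t • d) j| = (1 - t) * ∑ j, |P.h x j| := by
    have h2 := hD.h_segment hP hx hxd h0 h1
    rw [add_sub_cancel_left, hD.h_eq hxd, hd.1.2.1, zero_sub] at h2
    rw [Finset.mul_sum]
    refine Finset.sum_congr rfl fun j _ => ?_
    have h3 : (P.h x + t • -P.h x) j = (1 - t) * P.h x j := by
      simp only [PiLp.add_apply, PiLp.smul_apply, PiLp.neg_apply, smul_eq_mul]
      ring
    rw [h2, h3, abs_mul, abs_of_nonneg (sub_nonneg.2 h1)]
  rw [add_sub_cancel_left, real_inner_smul_right, norm_smul, Real.norm_of_nonneg h0,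
    mul_pow] at hf'
  have hgR := mul_le_mul_of_nonneg_left hg' hR
  have hkey : t * (inner ℝ (gradient P.f x) d + (P.q (x + d) - P.q x)) ≤
      t * (R * (∑ i, max (P.g x i) 0 + ∑ j, |P.h x j|) - c / 2 * ‖d‖ ^ 2) :=
    mul_le_mul_of_nonneg_left (by linarith) h0
  simp only [merit]
  rw [hh']
  linarith

/-- A limit of points along which the directions vanish is a KKT solution. -/
theorem isKKT_of_tendsto_direction (hP : P.Standing) (hβ : 0 < β)
    (hA : P.AssumptionA ft β Od Ox)
    (hβK : ∀ x ∈ P.K, ∀ y ∈ P.K, ∀ i, |x i - y i| ≤ β) (hD : P.AssumptionD A b)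
    {x d : ℕ → E n} {z : E n} (hx : ∀ k, x k ∈ P.K) (hd : ∀ k, P.IsDirection A b ft (x k) (d k))
    (hxz : Tendsto x atTop (𝓝 z)) (hd0 : Tendsto d atTop (𝓝 0)) : P.IsKKT z := by
  have hz : z ∈ P.K := hP.closed.mem_of_tendsto hxz (Eventually.of_forall hx)
  obtain ⟨R, -, hmul⟩ := exists_direction_multiplier hP hA hβK hD
  choose μ₀ hμ₀ hμ₀R hmin₀ using fun k => hmul (x k) (hx k) (d k) (hd k)
  obtain ⟨μ, -, φ, hφ, hμlim⟩ := (isCompact_closedBall (0 : E m × E p) R).tendsto_subseq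
    (x := μ₀) fun k => mem_closedBall_zero_iff.2 (hμ₀R k)
  have hxK : Tendsto (fun k => x (φ k)) atTop (𝓝[P.K] z) :=
    tendsto_nhdsWithin_iff.2 ⟨hxz.comp hφ.tendsto_atTop, Eventually.of_forall fun k => hx _⟩
  have hx' : Tendsto (fun k => x (φ k)) atTop (𝓝 z) := hxK.mono_right nhdsWithin_le_nhds
  have hd' : Tendsto (fun k => d (φ k)) atTop (𝓝 0) := hd0.comp hφ.tendsto_atTop
  have hxd : Tendsto (fun k => x (φ k) + d (φ k)) atTop (𝓝[P.K] z) :=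
    tendsto_nhdsWithin_iff.2 ⟨by simpa using hx'.add hd',
      Eventually.of_forall fun k => (hd _).1.2.2⟩
  have hg : Tendsto (fun k => P.g (x (φ k))) atTop (𝓝 (P.g z)) :=
    (hP.continuousOn_g z hz).tendsto.comp hxK
  have hgrad : ∀ i, Tendsto (fun k => gradient (fun y => P.g y i) (x (φ k))) atTop
      (𝓝 (gradient (fun y => P.g y i) z)) := fun i =>
    (hP.continuousOn_gradient_g i z hz).tendsto.comp hxK
  have hμ1 : Tendsto (fun k => (μ₀ (φ k)).1) atTop (𝓝 μ.1) :=
    (continuous_fst.tendsto μ).comp hμlim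
  have hμ2 : Tendsto (fun k => (μ₀ (φ k)).2) atTop (𝓝 μ.2) :=
    (continuous_snd.tendsto μ).comp hμlim
  have hcoord : ∀ {k : ℕ} {u : ℕ → E k} {v : E k}, Tendsto u atTop (𝓝 v) → ∀ i,
      Tendsto (fun ν => u ν i) atTop (𝓝 (v i)) := fun {k u v} h i =>
    ((by fun_prop : Continuous fun w : E k => w i).tendsto v).comp h
  have hμ : ∀ i, 0 ≤ μ.1 i := fun i => ge_of_tendsto' (hcoord hμ1 i) fun k => hμ₀ _ i
  have hjac : Tendsto (fun k => jacT P.g (x (φ k)) (μ₀ (φ k)).1) atTop (𝓝 (jacT P.g z μ.1)) :=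
    tendsto_finsetSum _ fun i _ => (hcoord hμ1 i).smul (hgrad i)
  have hgz : ∀ i, P.g z i ≤ 0 := fun i => by
    have h1 : Tendsto (fun k => P.g (x (φ k)) i +
        inner ℝ (gradient (fun y => P.g y i) (x (φ k))) (d (φ k))) atTop (𝓝 (P.g z i + 0)) := by
      refine (hcoord hg i).add ?_
      simpa using (hgrad i).inner (𝕜 := ℝ) hd'
    rw [add_zero] at h1
    exact le_of_tendsto' h1 fun k => (hd _).1.1 i
  have hhz : P.h z = 0 := by
    have h1 : Tendsto (fun k => P.h (x (φ k) + d (φ k))) atTop (𝓝 (P.h z)) :=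
      (hP.continuousOn_h z hz).tendsto.comp hxd
    refine tendsto_nhds_unique h1 (tendsto_const_nhds.congr fun k => ?_)
    rw [hD.h_eq (hd _).1.2.2, (hd _).1.2.1]
  have hft : ∀ {e : ℕ → E n} {e₀ : E n}, e₀ ∈ Od → Tendsto e atTop (𝓝 e₀) →
      Tendsto (fun k => ft (e k) (x (φ k))) atTop (𝓝 (ft e₀ z)) := fun {e e₀} he₀ he => by
    have hnhds : Od ×ˢ Ox ∈ 𝓝 (e₀, z) :=
      (hA.Od_open.prod hA.Ox_open).mem_nhds ⟨he₀, hA.K_subset hz⟩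
    have hcont := (hA.cont.continuousAt hnhds).tendsto
    exact hcont.comp (he.prodMk_nhds hx')
  have hmin : ∀ y ∈ P.K, ft 0 z + P.q z ≤ ft (y - z) z + P.q y +
      (inner ℝ μ.1 (P.g z) + inner ℝ (jacT P.g z μ.1) (y - z) + inner ℝ μ.2 (P.h y)) := by
    intro y hy
    have hyx : Tendsto (fun k => y - x (φ k)) atTop (𝓝 (y - z)) := tendsto_const_nhds.sub hx'
    refine le_of_tendsto_of_tendsto' ((hft (hA.zero_mem hβ) hd').add
      ((hP.continuousOn_q z hz).tendsto.comp hxd)) (((hft (hA.sub_mem hβK hz hy) hyx).add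
        tendsto_const_nhds).add (((hμ1.inner hg).add (hjac.inner hyx)).add
          (hμ2.inner tendsto_const_nhds))) fun k => hmin₀ (φ k) y hy
  -- Complementarity is the limit inequality tested at `y = z`.
  have hcompl : inner ℝ μ.1 (P.g z) = 0 := by
    refine le_antisymm (inner_nonpos_of_nonneg_of_nonpos hμ hgz) ?_
    simpa [hhz] using hmin z hz
  set G := gradient P.f z + jacT P.g z μ.1 + jacT P.h z μ.2
  -- Subgradients only see points of `K`, so `subdiff` already absorbs normal directions and `0` can
  -- be taken as the normal vector.
  refine ⟨hz, hgz, hhz, μ, mem_normalCone_nonposOrthant hμ hgz hcompl.ge,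
    ⟨hhz, fun y hy => by simp [mem_singleton_iff.1 hy, hhz]⟩, -G, fun y hy => ?_, 0,
    ⟨hz, by simp⟩, by simp only [G]; module⟩
  have hderiv := hasDerivAt_line (hA.differentiableAt_zero hβ hz) (y - z)
  rw [hA.grad_zero z hz] at hderiv
  -- Convexity of `q` makes its increment along the segment at most linear in `t`, so only the
  -- surrogate is differentiated, at `0`, where its gradient is that of `f`.
  have hline := le_deriv_of_forall_add_mul_le
    (a := -(P.q y - P.q z + inner ℝ (jacT P.g z μ.1) (y - z) + inner ℝ μ.2 (P.h y))) (C := 0)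
    hderiv fun t h0 h1 => by
      have h2 := hmin _ (segment_mem hP.convex hz hy h0.le h1)
      have h3 := ConvexOn.le_segment hP.q_convex hz hy h0.le h1
      rw [hD.h_segment hP hz hy h0.le h1, hcompl, hhz, add_sub_cancel_left,
        real_inner_smul_right, zero_add, zero_add, sub_zero, real_inner_smul_right] at h2
      simp only [zero_smul, zero_add]
      linarith
  have hjh := hD.inner_jacT_h hP hz hy μ.2
  rw [hhz, sub_zero] at hjh
  simp only [G, inner_neg_left, inner_add_left]
  linarith

theorem IsRun.mem (hP : P.Standing) {γ : ℕ → ℝ} (hγ : IsStepsize γ) {x : ℕ → E n}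
    (hx : P.IsRun A b ft γ x) (ν : ℕ) : x ν ∈ P.K := by
  induction ν with
  | zero => exact hx.init
  | succ ν ih =>
    by_cases hk : P.IsKKT (x ν)
    · rwa [hx.stay ν hk]
    · obtain ⟨d, hd, hstep⟩ := hx.move ν hk
      rw [hstep]
      simpa using segment_mem hP.convex ih hd.1.2.2 (hγ.pos ν).le (hγ.le_one ν)

theorem IsRun.isKKT_of_mapClusterPt (hP : P.Standing) (hβ : 0 < β)
    (hA : P.AssumptionA ft β Od Ox)
    (hβK : ∀ x ∈ P.K, ∀ y ∈ P.K, ∀ i, |x i - y i| ≤ β) (hD : P.AssumptionD A b) {γ : ℕ → ℝ}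
    (hγ : IsStepsize γ) {x : ℕ → E n} (hx : P.IsRun A b ft γ x) {z : E n}
    (hz : MapClusterPt z atTop x) : P.IsKKT z := by
  by_cases hkkt : ∃ ν, P.IsKKT (x ν)
  · obtain ⟨ν, hν⟩ := hkkt
    have hconst : ∀ k, x (ν + k) = x ν := fun k => by
      induction k with
      | zero => rfl
      | succ k ih => rw [← add_assoc, hx.stay _ (ih ▸ hν), ih]
    have hlim : Tendsto x atTop (𝓝 (x ν)) := tendsto_const_nhds.congr' <| by
      filter_upwards [eventually_ge_atTop ν] with k hk
      obtain ⟨j, rfl⟩ := Nat.exists_eq_add_of_le hk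
      exact (hconst j).symm
    obtain ⟨ψ, hψ, hψz⟩ := hz.tendsto_subseq
    rwa [tendsto_nhds_unique hψz (hlim.comp hψ.tendsto_atTop)]
  · push Not at hkkt
    have hxK := hx.mem hP hγ
    choose d hd hstep using fun ν => hx.move ν (hkkt ν)
    by_contra hnot
    -- One `r` serves as radius and as lower bound on the directions; failure for every `r = 1 / (k
    -- + 1)` would give points tending to `z` with vanishing directions.
    have hfar : ∃ r > 0, ∀ ν, dist (x ν) z < r → r ≤ ‖d ν‖ := by
      by_contra! hcon
      choose ν h1 h2 using fun k : ℕ => hcon (1 / ((k : ℝ) + 1)) (by positivity)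
      refine hnot (isKKT_of_tendsto_direction hP hβ hA hβK hD (x := x ∘ ν) (d := d ∘ ν)
        (fun k => hxK _) (fun k => hd _) ?_ ?_)
      · exact tendsto_iff_dist_tendsto_zero.2 (squeeze_zero (fun _ => dist_nonneg)
          (fun k => (h1 k).le) tendsto_one_div_add_atTop_nhds_zero_nat)
      · exact squeeze_zero_norm (fun k => (h2 k).le) tendsto_one_div_add_atTop_nhds_zero_nat
    obtain ⟨r, hr, hfar⟩ := hfar
    obtain ⟨R, c, L, hc, hdesc⟩ := exists_merit_descent hP hβ hA hβK hD
    obtain ⟨C, hC⟩ := (hD.isCompact hP).exists_bound_of_continuousOn (hP.continuousOn_merit R)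
    exact not_mapClusterPt_of_descent (W := fun ν => P.merit R (x ν)) (w := -C) hγ hc hr hr hstep
      (fun ν => by
        simp only [hstep ν]
        exact hdesc _ (hxK ν) _ (hd ν) _ (hγ.pos ν).le (hγ.le_one ν))
      (fun ν => (abs_le.1 (hC _ (hxK ν))).1) hfar hz

end Problem

end GhostDSM

theorem theorem2 {n m p : ℕ} (P : GhostDSM.Problem n m p) (hP : P.Standing)
    (ft : GhostDSM.E n → GhostDSM.E n → ℝ) (β : ℝ) (hβ : 0 < β)
    (hβK : ∀ x ∈ P.K, ∀ y ∈ P.K, ∀ i, |x i - y i| ≤ β)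
    (Od Ox : Set (GhostDSM.E n)) (hA : P.AssumptionA ft β Od Ox)
    (hC : GhostDSM.Problem.AssumptionC ft Od Ox)
    (A : Matrix (Fin p) (Fin n) ℝ) (b : GhostDSM.E p) (hD : P.AssumptionD A b) :
    (∀ x ∈ P.K, ∃! d, P.IsDirection A b ft x d) ∧
    ∀ γ : ℕ → ℝ, GhostDSM.Problem.IsStepsize γ →
    ∀ x : ℕ → GhostDSM.E n, P.IsRun A b ft γ x →
      Bornology.IsBounded (Set.range x) ∧ (∀ ν, x ν ∈ P.K) ∧
      ∀ z, MapClusterPt z Filter.atTop x → P.IsKKT z :=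
  ⟨fun _ hx => GhostDSM.Problem.existsUnique_isDirection hP hA hβK hD hx, fun _ hγ _ hx =>
    ⟨hD.bounded.subset (Set.range_subset_iff.2 (hx.mem hP hγ)), hx.mem hP hγ,
      fun _ hz => hx.isKKT_of_mapClusterPt hP hβ hA hβK hD hγ hz⟩⟩
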